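/- Let $a,b,c$ be pairwise different letters and let $n\ge 1$. For a permutation $\tau$ of the letters with $\tau^2=\mathrm{id}$, let $\mathcal V$ be the antimorphism of finite words $\mathcal V(x_1\cdots x_m)=\tau(x_m)\cdots\tau(x_1)$. The $\mathcal V$-palindromic closure of a finite word $u$ is $u^{\oplus}=sq\mathcal V(s)$, where $u=sq$ and $q$ is the longest suffix of $u$ with $\mathcal V(q)=q$; put $\mathrm{Pal}_{\mathcal V}(\varepsilon)=\varepsilon$ and $\mathrm{Pal}_{\mathcal V}(ux)=(\mathrm{Pal}_{\mathcal V}(u)x)^{\oplus}$ for finite words $u$ and letters $x$. Write $\mathrm{Pal}_{\mathcal H}$ for this operator when $\tau$ fixes $a$ and exchanges $b$ and $c$, and $\mathrm{Pal}$ when $\tau=\mathrm{id}$. For an infinite word $\mathbf s=s[1]s[2]\cdots$ put $\mathrm{IPal}(\mathbf s)=\lim_{m\to\infty}\mathrm{Pal}(s[1]\cdots s[m])$. Then the limits $$\mathbf s_{\mathcal H,n,a,b,c}=\lim_{i\to\infty}\mathrm{Pal}_{\mathcal H}^{\,i}(a^nb),\qquad \mathbf w_{\mathcal H,n}=\mathrm{IPal}(\mathbf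 s_{\mathcal H,n,a,b,c})$$ exist as infinite words, and $\mathbf w_{\mathcal H,n}$ is a strict standard episturmian word over $\{a,b,c\}$, that is, of the form $\mathrm{IPal}(\Delta)$ for some infinite word $\Delta$ over $\{a,b,c\}$ in which each of the three letters occurs infinitely often. Moreover $\mathbf w_{\mathcal H,n}$ is $(n+4)$-th power-free, i.e. no word $u^{n+4}$ with $u$ nonempty is a factor of it, but it contains an $(n+3)$-th power, i.e. some $u^{n+3}$ with $u$ nonempty is a factor of it. -/

import Mathlib

open Filter

namespace EpiWords

variable {α : Type*}

/-- The antimorphism `R ∘ τ` of the free monoid: apply the letter permutation `τ` to every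
letter, then reverse. For `τ = 1` it is the reversal `R`. -/
def anti (τ : Equiv.Perm α) (u : List α) : List α := (u.map τ).reverse

/-- The empty suffix is a pseudopalindrome. -/
theorem exists_drop_pal (τ : Equiv.Perm α) (u : List α) :
    ∃ i, anti τ (u.drop i) = u.drop i :=
  ⟨u.length, by simp [anti]⟩

open Classical in
/-- The length of `s`, where `u = s q` and `q` is the longest suffix of `u` that is fixed
by the antimorphism `anti τ`. -/
noncomputable def cut (τ : Equiv.Perm α) (u : List α) : ℕ := Nat.find (exists_drop_pal τ u)

/-- The pseudopalindromic closure of `u`: the word `s q 𝒱(s)`, where `𝒱 = anti τ` and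
`u = s q` with `q` the longest `𝒱`-palindromic suffix of `u`. -/
noncomputable def palClosure (τ : Equiv.Perm α) (u : List α) : List α :=
  u ++ anti τ (u.take (cut τ u))

/-- The iterated pseudopalindromic closure of a finite word: `Pal(ε) = ε` and
`Pal(u x)` is the pseudopalindromic closure of `Pal(u) x`. -/
noncomputable def Pal (τ : Equiv.Perm α) (u : List α) : List α :=
  u.foldl (fun p x => palClosure τ (p ++ [x])) []

theorem Pal_nil (τ : Equiv.Perm α) : Pal τ [] = [] := rfl

theorem Pal_append_singleton (τ : Equiv.Perm α) (u : List α) (x : α) :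
    Pal τ (u ++ [x]) = palClosure τ (Pal τ u ++ [x]) := by
  simp [Pal]

/-- The infinite word `w` is the limit of the sequence `u` of finite words: every position
of `u i` is, for all large `i`, present and occupied by the letter of `w`. -/
def IsLimitWord (u : ℕ → List α) (w : ℕ → α) : Prop :=
  ∀ k, ∀ᶠ i in atTop, (u i)[k]? = some (w k)

/-- Limits are unique, so that one may speak of the limit of a sequence of finite words. -/
theorem IsLimitWord.unique {u : ℕ → List α} {w w' : ℕ → α}
    (h : IsLimitWord u w) (h' : IsLimitWord u w') : w = w' := by
  funext k
  obtain ⟨i, hi, hi'⟩ := ((h k).and (h' k)).exists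
  exact Option.some.inj (hi.symm.trans hi')

/-- The block `w[i] w[i+1] ⋯ w[i+m-1]` of an infinite word. -/
def block (w : ℕ → α) (i m : ℕ) : List α := (List.range m).map (fun j => w (i + j))

/-- `w = IPal(Δ)` for the antimorphism `anti τ`: the infinite word `w` is the limit of the
words `Pal(Δ[0] ⋯ Δ[m-1])`. -/
def IsIPal (τ : Equiv.Perm α) (Δ w : ℕ → α) : Prop :=
  IsLimitWord (fun m => Pal τ (block Δ 0 m)) w

/-- `w` is a strict standard episturmian word over the alphabet `A`: it is directed, through
the (reversal) iterated palindromic closure, by an infinite word over `A` in which each letter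
of `A` occurs infinitely often. -/
def IsStrictStandardEpisturmian (A : Set α) (w : ℕ → α) : Prop :=
  ∃ Δ : ℕ → α, (∀ i, Δ i ∈ A) ∧ (∀ x ∈ A, ∃ᶠ i in atTop, Δ i = x) ∧ IsIPal 1 Δ w

/-- `s = s_{ℋ,n,a,b,c}`: the limit of `Pal_ℋ^i(aⁿ b)` as `i → ∞`, where the hybrid
antimorphism `ℋ` is `R ∘ τ` with `τ` exchanging `b` and `c` and fixing `a`. -/
def IsHybridFixedWord [DecidableEq α] (n : ℕ) (a b c : α) (s : ℕ → α) : Prop :=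
  IsLimitWord (fun i => (Pal (Equiv.swap b c))^[i] (List.replicate n a ++ [b])) s

/-- The finite word `v` is a factor of the infinite word `w`. -/
def IsFactor (v : List α) (w : ℕ → α) : Prop := ∃ i, block w i v.length = v

/-- The infinite word `w` contains a `k`-th power `u ^ k` with `u` nonempty. -/
def ContainsPower (k : ℕ) (w : ℕ → α) : Prop :=
  ∃ u : List α, u ≠ [] ∧ IsFactor (List.replicate k u).flatten w

/-- The infinite word `w` is `k`-th power-free. -/
def IsPowerFree (k : ℕ) (w : ℕ → α) : Prop := ¬ ContainsPower k w

end EpiWords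

namespace EpiWords

variable {α : Type*}

/-! ### Pseudopalindromic closure: generalities -/

section Closure

/-! Two formulas make closures computable. Write ψ_x for `epi x` (it sends x to x and y to xy for y
≠ x) and ψ_v for `epiComp v`. Justin's formula `Pal_one_cons` says Pal(xu) = ψ_x(Pal(u))x. For an
involution τ, `Pal_eq_doubling` turns Pal_τ into Pal followed by the insertion of τ(y) after every y
with τ(y) ≠ y.

Powers in IPal(Δ) are governed by the runs of Δ. If runs have length at most l, no (l+3)-th power
occurs (`power_not_infix`): a periodic factor z with period word u is desubstituted letter by
letter, and (l+3)|ψ_v(u)| ≤ |ψ_v(z)| + |Pal(v)| persists, v being the part of the directive word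
already consumed. Once u is a power of one letter x, the leading x-run of the remaining word and the
trailing x-run of v join into a run too long for Δ. Conversely, a block x^m with x both before and
after it yields an (m+2)-th power (`power_infix`).

It remains to see that the longest run in the hybrid word is n+1. Each iterate after the start is
the doubling of Pal of a word beginning with a^n b. Runs in Pal(δ) exceed the leading run of δ by at
most one, doubling keeps the runs of fixed letters, and runs of b and c have length at most 2 ≤ n+1
(`runsLE_hybrid_succ`). The block a^(n+1) appears in the second iterate, with a on either side
(`exists_hybrid_two_eq`). -/

theorem anti_append (τ : Equiv.Perm α) (u v : List α) :
    anti τ (u ++ v) = anti τ v ++ anti τ u := by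
  simp [anti]

theorem anti_one (u : List α) : anti 1 u = u.reverse := by
  simp [anti]

theorem palClosure_eq (τ : Equiv.Perm α) {s q : List α} (hq : anti τ q = q)
    (hmin : ∀ s' q', s' ++ q' = s ++ q → anti τ q' = q' → s.length ≤ s'.length) :
    palClosure τ (s ++ q) = s ++ q ++ anti τ s := by
  have hc : cut τ (s ++ q) = s.length := by
    classical
    unfold cut
    rw [Nat.find_eq_iff]
    refine ⟨by simpa using hq, fun m hm h => ?_⟩
    have := hmin ((s ++ q).take m) ((s ++ q).drop m) (List.take_append_drop _ _) h
    simp only [List.length_take] at this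
    omega
  simp [palClosure, hc]

theorem exists_longest_pal_suffix (τ : Equiv.Perm α) (u : List α) :
    ∃ s q, u = s ++ q ∧ anti τ q = q ∧
      (∀ s' q', s' ++ q' = s ++ q → anti τ q' = q' → s.length ≤ s'.length) := by
  classical
  refine ⟨u.take (cut τ u), u.drop (cut τ u), (List.take_append_drop _ _).symm, ?_, ?_⟩
  · unfold cut
    exact Nat.find_spec (exists_drop_pal τ u)
  · intro s' q' h hq'
    rw [List.take_append_drop] at h
    have : cut τ u ≤ s'.length := by
      unfold cut
      apply Nat.find_min'
      simpa [← h] using hq'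
    simp only [List.length_take]
    omega

theorem append_singleton_prefix_Pal (τ : Equiv.Perm α) (u : List α) (x : α) :
    Pal τ u ++ [x] <+: Pal τ (u ++ [x]) := by
  rw [Pal_append_singleton]
  exact List.prefix_append _ _

theorem Pal_prefix_append (τ : Equiv.Perm α) (u v : List α) :
    Pal τ u <+: Pal τ (u ++ v) ∧ (Pal τ u).length + v.length ≤ (Pal τ (u ++ v)).length := by
  induction v using List.reverseRecOn with
  | nil => simp
  | append_singleton v x ih =>
    have h := append_singleton_prefix_Pal τ (u ++ v) x
    rw [List.append_assoc] at h
    refine ⟨(ih.1.trans (List.prefix_append _ _)).trans h, ?_⟩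
    have := h.length_le
    simp only [List.length_append, List.length_singleton] at this ⊢
    omega

end Closure

/-! ### Episturmian morphisms and their decoding -/

section Decode

variable [DecidableEq α]

/-- The episturmian morphism `y ↦ x y` for `y ≠ x`, `x ↦ x`. -/
def epi (x : α) (u : List α) : List α := u.flatMap fun y => if y = x then [x] else [x, y]

@[simp] theorem epi_nil (x : α) : epi x [] = [] := rfl

@[simp] theorem epi_append (x : α) (u v : List α) : epi x (u ++ v) = epi x u ++ epi x v := by
  simp [epi]

theorem epi_cons (x y : α) (u : List α) :
    epi x (y :: u) = (if y = x then [x] else [x, y]) ++ epi x u := by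
  simp [epi]

@[simp] theorem epi_cons_self (x : α) (u : List α) : epi x (x :: u) = x :: epi x u := by
  simp [epi]

theorem epi_cons_of_ne {x y : α} (h : y ≠ x) (u : List α) :
    epi x (y :: u) = x :: y :: epi x u := by
  simp [epi, h]

theorem reverse_epi_append (x : α) (u : List α) :
    (epi x u ++ [x]).reverse = epi x u.reverse ++ [x] := by
  induction u with
  | nil => simp
  | cons y u ih =>
    by_cases h : y = x
    · subst h
      rw [epi_cons_self, List.cons_append, List.reverse_cons, ih]
      simp
    · rw [epi_cons_of_ne h, List.cons_append, List.cons_append, List.reverse_cons,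
        List.reverse_cons, ih]
      simp [epi_cons_of_ne h]

/-- The left inverse of `u ↦ epi x u ++ [x]`: it deletes every `x` not followed by `x`. -/
def unepi (x : α) : List α → List α
  | [] => []
  | y :: u => if y = x ∧ u.head? ≠ some x then unepi x u else y :: unepi x u

@[simp] theorem unepi_nil (x : α) : unepi x [] = [] := rfl

theorem unepi_cons (x y : α) (u : List α) : unepi x (y :: u) =
    if y = x ∧ u.head? ≠ some x then unepi x u else y :: unepi x u := rfl

theorem unepi_cons_of_ne {x y : α} (h : y ≠ x) (u : List α) :
    unepi x (y :: u) = y :: unepi x u := by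
  simp [unepi_cons, h]

theorem unepi_cons_cons_self (x : α) (u : List α) :
    unepi x (x :: x :: u) = x :: unepi x (x :: u) := by
  rw [unepi_cons]; simp

@[simp] theorem unepi_singleton (x : α) : unepi x [x] = [] := by
  simp [unepi_cons]

theorem unepi_suffix {x : α} {u v : List α} (h : u <:+ v) : unepi x u <:+ unepi x v := by
  induction v with
  | nil => simp_all
  | cons y v ih =>
    rcases List.suffix_cons_iff.1 h with rfl | h
    · exact List.suffix_rfl
    · refine (ih h).trans ?_
      rw [unepi_cons]
      split_ifs
      · exact List.suffix_rfl
      · exact List.suffix_cons _ _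

/-- Whether a letter survives depends only on its right neighbour, so only the last letter of `u`
can be treated differently in `v`. A final x is deleted in `u`, so the decoding of `u` can only be
shorter. -/
theorem unepi_prefix {x : α} {u v : List α} (h : u <+: v) : unepi x u <+: unepi x v := by
  induction u generalizing v with
  | nil => simp
  | cons y u ih =>
    obtain ⟨t, rfl⟩ := h
    have ih' := ih (List.prefix_append u t)
    rw [List.cons_append, unepi_cons, unepi_cons]
    cases u with
    | nil =>
      by_cases h : y = x
      · simp [h]
      · simp [h]
    | cons y' u =>
      have e : (y' :: u ++ t).head? = (y' :: u).head? := by simp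
      rw [e]
      split_ifs
      · exact ih'
      · exact (List.prefix_cons_inj _).2 ih'

theorem unepi_infix {x : α} {u v : List α} (h : u <:+: v) : unepi x u <:+: unepi x v := by
  obtain ⟨s, t, rfl⟩ := h
  exact ((unepi_suffix (List.suffix_append s u)).isInfix).trans
    (unepi_prefix (List.prefix_append (s ++ u) t)).isInfix

theorem head?_epi_append_cons (x : α) (u v : List α) : (epi x u ++ x :: v).head? = some x := by
  cases u with
  | nil => simp
  | cons y u => by_cases h : y = x <;> simp [epi_cons, h]

theorem unepi_epi (x : α) (u : List α) : unepi x (epi x u ++ [x]) = u := by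
  induction u with
  | nil => simp
  | cons y u ih =>
    by_cases h : y = x
    · subst h
      rw [epi_cons_self, List.cons_append, unepi_cons, head?_epi_append_cons]
      simp [ih]
    · rw [epi_cons_of_ne h, List.cons_append, List.cons_append, unepi_cons,
        unepi_cons_of_ne h, ih]
      simp [h]

theorem unepi_append_cons (x : α) (u v : List α) :
    unepi x (u ++ x :: v) = unepi x (u ++ [x]) ++ unepi x (x :: v) := by
  induction u with
  | nil => simp
  | cons y u ih =>
    have : (u ++ x :: v).head? = (u ++ [x]).head? := by cases u <;> simp
    rw [List.cons_append, unepi_cons, List.cons_append, unepi_cons, ih, this]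
    split_ifs <;> simp

/-- No two consecutive letters are both different from `x`. -/
abbrev Separated (x : α) (u : List α) : Prop := u.IsChain fun y z => y = x ∨ z = x

theorem separated_epi (x : α) (u : List α) : Separated x (epi x u ++ [x]) := by
  induction u with
  | nil => simp
  | cons y u ih =>
    have hh := head?_epi_append_cons x u []
    by_cases h : y = x
    · subst h
      rw [epi_cons_self, List.cons_append]
      exact List.isChain_cons.2 ⟨fun _ _ => Or.inl rfl, ih⟩
    · rw [epi_cons_of_ne h, List.cons_append, List.cons_append]
      refine List.isChain_cons.2 ⟨fun _ _ => Or.inl rfl, List.isChain_cons.2 ⟨fun z hz => ?_, ih⟩⟩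
      rw [hh] at hz
      simp_all

theorem epi_unepi {x : α} {u : List α} (h : Separated x (u ++ [x]))
    (hh : (u ++ [x]).head? = some x) : epi x (unepi x (u ++ [x])) = u := by
  induction hn : u.length using Nat.strong_induction_on generalizing u with
  | _ n ih =>
    subst hn
    match u, h, hh with
    | [], _, _ => simp
    | [y], _, hh => 
      obtain rfl : y = x := by simpa using hh
      simp [unepi_cons]
    | y :: z :: u, h, hh =>
      obtain rfl : y = x := by simpa using hh
      by_cases hz : z = y
      · subst hz
        have := ih (z :: u).length (by simp) (u := z :: u) (by simpa using h.tail) (by simp) rfl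
        rw [List.cons_append, List.cons_append, unepi_cons_cons_self, epi_cons_self]
        rw [List.cons_append] at this
        rw [this]
      · have h1 : Separated y (z :: (u ++ [y])) := by simpa using h.tail
        have h2 := List.isChain_cons.1 h1
        have h3 : (u ++ [y]).head? = some y := by
          cases u with
          | nil => simp
          | cons t u =>
            have := h2.1 t (by simp)
            simp_all
        have := ih u.length (by simp) (u := u) h2.2 h3 rfl
        rw [List.cons_append, List.cons_append, unepi_cons, if_pos (by simp [hz]),
          unepi_cons_of_ne hz, epi_cons_of_ne hz, this]

end Decode

/-! ### Justin's formula -/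

section Justin

variable [DecidableEq α]

theorem epi_unepi_of_reverse {x : α} {u q : List α} (hu : u <:+: epi x q ++ [x]) (hne : u ≠ [])
    (hx : u.getLast? = some x) (hp : u.reverse = u) :
    u = epi x (unepi x u) ++ [x] ∧ (unepi x u).reverse = unepi x u := by
  have hs : Separated x u := (separated_epi x q).infix hu
  have hh : u.head? = some x := by rw [← hx, ← List.head?_reverse, hp]
  obtain ⟨v, rfl⟩ : ∃ v, u = v ++ [x] := by
    obtain ⟨v, hv⟩ := List.getLast?_eq_some_iff.1 hx
    exact ⟨v, hv⟩
  have h1 := epi_unepi hs hh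
  have h2 : v ++ [x] = epi x (unepi x (v ++ [x])) ++ [x] := by rw [h1]
  refine ⟨h2, ?_⟩
  have h3 := hp
  rw [h2, reverse_epi_append] at h3
  have := congrArg (unepi x) h3
  rwa [unepi_epi, unepi_epi] at this

/-- A nonempty palindromic suffix of ψ_x(q)x ends, hence begins, with x. It therefore decodes to
ψ_x(p)x for a palindromic suffix p of q, and longest suffixes correspond. -/
theorem palClosure_epi_append (x : α) (q : List α) :
    palClosure 1 (epi x q ++ [x]) = epi x (palClosure 1 q) ++ [x] := by
  obtain ⟨s, p, rfl, hp, hmin⟩ := exists_longest_pal_suffix 1 q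
  rw [palClosure_eq 1 hp hmin]
  have hp' : anti 1 (epi x p ++ [x]) = epi x p ++ [x] := by
    rw [anti_one] at hp ⊢
    rw [reverse_epi_append, hp]
  have key := palClosure_eq 1 (s := epi x s) hp' ?_
  · rw [epi_append, List.append_assoc, key, anti_one, anti_one, epi_append, epi_append]
    have := reverse_epi_append x s
    rw [List.reverse_append] at this
    simp only [List.reverse_singleton] at this
    rw [List.append_assoc, List.append_assoc, List.append_assoc, List.append_assoc, this]
  · intro s' q' h hq'
    rw [← List.append_assoc, ← epi_append] at h
    rcases eq_or_ne q' [] with rfl | hne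
    · have := congrArg List.length h
      simp at this ⊢
      omega
    rw [anti_one] at hq'
    have hsuf : q' <:+ epi x (s ++ p) ++ [x] := ⟨s', h⟩
    have hl : q'.getLast? = some x := by
      have := congrArg List.getLast? h
      simpa [List.getLast?_append, hne] using this
    obtain ⟨e1, e2⟩ := epi_unepi_of_reverse hsuf.isInfix hne hl hq'
    have h3 := unepi_suffix (x := x) hsuf
    rw [unepi_epi] at h3
    obtain ⟨s'', hs''⟩ := h3
    have h4 := hmin s'' (unepi x q') hs'' (by rw [anti_one, e2])
    have h5 : s' = epi x s'' := by
      rw [e1, ← hs'', epi_append, ← List.append_assoc] at h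
      have := List.append_cancel_right h
      exact List.append_cancel_right this
    have h6 : s <+: s'' :=
      List.prefix_of_prefix_length_le (List.prefix_append _ _) ⟨_, hs''⟩ h4
    obtain ⟨t, rfl⟩ := h6
    rw [h5]
    simp

/-- The longest palindromic suffix p begins and ends with z ≠ x, so it is preceded by x. Then xpx is
the longest palindromic suffix once x is appended, and both words close up to the same palindrome.
-/
theorem palClosure_epi_append_of_ne {x z : α} (hz : z ≠ x) (q : List α) :
    palClosure 1 (epi x q ++ [x] ++ [z]) = palClosure 1 (epi x (q ++ [z]) ++ [x]) := by
  obtain ⟨s, p, hsp, hp, hmin⟩ := exists_longest_pal_suffix 1 (epi x q ++ [x] ++ [z])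
  have hsep : Separated x (epi x q ++ [x] ++ [z]) := by
    have := separated_epi x (q ++ [z])
    simp only [epi_append, epi_cons_of_ne hz, epi_nil] at this
    refine this.infix ⟨[], [x], by simp⟩
  have hpne : p ≠ [] := by
    rintro rfl
    have := hmin (epi x q ++ [x]) [z] (by rw [hsp]) (by simp [anti])
    have h2 := congrArg List.length hsp
    simp at this h2
    omega
  have hpl : p.getLast? = some z := by
    have := congrArg List.getLast? hsp
    simpa [List.getLast?_append, hpne] using this.symm
  have hph : p.head? = some z := by
    rw [anti_one] at hp
    rw [← hpl, ← List.head?_reverse, hp]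
  obtain ⟨p', rfl⟩ : ∃ p', p = z :: p' := by
    cases p with
    | nil => simp at hph
    | cons y p' => exact ⟨p', by simp_all⟩
  obtain ⟨s1, rfl⟩ : ∃ s1, s = s1 ++ [x] := by
    rcases List.eq_nil_or_concat s with rfl | ⟨s1, y, rfl⟩
    · have := congrArg List.head? hsp
      rw [List.append_assoc, List.singleton_append, head?_epi_append_cons] at this
      simp at this
      exact absurd this.symm hz
    · rw [hsp] at hsep
      have h1 : [y, z] <:+: s1.concat y ++ z :: p' := ⟨s1, p', by simp⟩
      have h2 : Separated x [y, z] := hsep.infix h1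
      have h3 : y = x := by simpa [hz] using h2
      exact ⟨s1, by simp [h3]⟩
  have e : epi x (q ++ [z]) ++ [x] = s1 ++ (x :: (z :: p') ++ [x]) := by
    rw [epi_append, epi_cons_of_ne hz, epi_nil]
    have : epi x q ++ [x, z] = epi x q ++ [x] ++ [z] := by simp
    rw [this, hsp]
    simp
  have hp' : anti 1 (x :: (z :: p') ++ [x]) = x :: (z :: p') ++ [x] := by
    rw [anti_one] at hp ⊢
    simp only [List.reverse_append, List.reverse_cons, List.cons_append] at hp ⊢
    simp [hp]
  rw [hsp, palClosure_eq 1 hp hmin, e, palClosure_eq 1 hp' ?_]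
  · simp [anti_one]
  · intro s' q' h hq'
    rcases eq_or_ne q' [] with rfl | hne
    · have := congrArg List.length h
      simp at this ⊢
      omega
    rw [anti_one] at hq'
    have hl : q'.getLast? = some x := by
      have h1 : s' ++ q' = (s1 ++ x :: z :: p') ++ [x] := by simpa using h
      have := congrArg List.getLast? h1
      rw [List.getLast?_concat] at this
      simpa [List.getLast?_append, hne] using this
    have hh : q'.head? = some x := by
      rw [← hl, ← List.head?_reverse, hq']
    obtain ⟨r, rfl⟩ : ∃ r, q' = x :: r := by
      cases q' with
      | nil => simp at hh
      | cons y r => exact ⟨r, by simp_all⟩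
    rcases List.eq_nil_or_concat r with rfl | ⟨r, y, rfl⟩
    · have := congrArg List.length h
      simp at this ⊢
      omega
    · obtain rfl : y = x := by
        rw [List.concat_eq_append, ← List.cons_append, List.getLast?_concat] at hl
        simpa using hl
      have hr : r.reverse = r := by simpa using hq'
      have h' : (s' ++ [y]) ++ r = (s1 ++ [y]) ++ z :: p' := by
        have : (s' ++ [y] ++ r) ++ [y] = (s1 ++ [y] ++ z :: p') ++ [y] := by simpa using h
        exact List.append_cancel_right this
      have := hmin _ _ h' (by rw [anti_one, hr])
      simpa using this

theorem Pal_one_cons (x : α) (u : List α) : Pal 1 (x :: u) = epi x (Pal 1 u) ++ [x] := by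
  induction u using List.reverseRecOn with
  | nil =>
    have : Pal 1 [x] = palClosure 1 (epi x [] ++ [x]) := rfl
    rw [this, palClosure_epi_append]
    simp [palClosure, Pal, anti]
  | append_singleton u z ih =>
    rw [← List.cons_append, Pal_append_singleton, Pal_append_singleton, ih]
    by_cases h : z = x
    · subst h
      rw [← palClosure_epi_append]
      simp
    · rw [palClosure_epi_append_of_ne h, palClosure_epi_append]

end Justin

end EpiWords

namespace EpiWords

variable {α : Type*} [DecidableEq α]

/-! ### From pseudopalindromic to palindromic closure -/

section Doubling

/-- The morphism `y ↦ y` if `τ y = y`, and `y ↦ y τ(y)` otherwise. -/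
def doubling (τ : Equiv.Perm α) (u : List α) : List α :=
  u.flatMap fun y => if τ y = y then [y] else [y, τ y]

variable {τ : Equiv.Perm α}

@[simp] theorem doubling_nil : doubling τ [] = [] := rfl

@[simp] theorem doubling_append (u v : List α) :
    doubling τ (u ++ v) = doubling τ u ++ doubling τ v := by
  simp [doubling]

theorem doubling_cons_of_eq {y : α} (h : τ y = y) (u : List α) :
    doubling τ (y :: u) = y :: doubling τ u := by
  simp [doubling, h]

theorem doubling_cons_of_ne {y : α} (h : τ y ≠ y) (u : List α) :
    doubling τ (y :: u) = y :: τ y :: doubling τ u := by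
  simp [doubling, h]

theorem doubling_prefix {u v : List α} (h : u <+: v) : doubling τ u <+: doubling τ v := by
  obtain ⟨t, rfl⟩ := h
  simp

theorem head?_doubling (u : List α) : (doubling τ u).head? = u.head? := by
  cases u with
  | nil => simp
  | cons y u => by_cases h : τ y = y <;> simp [doubling, h]

theorem doubling_injective : Function.Injective (doubling τ) := by
  intro u v h
  induction u generalizing v with
  | nil =>
    have := congrArg List.head? h
    rw [head?_doubling, head?_doubling] at this
    simpa [eq_comm] using this
  | cons y u ih =>
    have := congrArg List.head? h
    rw [head?_doubling, head?_doubling] at this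
    cases v with
    | nil => simp at this
    | cons z v =>
      obtain rfl : y = z := by simpa using this
      by_cases hy : τ y = y
      · rw [doubling_cons_of_eq hy, doubling_cons_of_eq hy] at h
        rw [ih (List.cons_injective h)]
      · rw [doubling_cons_of_ne hy, doubling_cons_of_ne hy] at h
        rw [ih (List.cons_injective (List.cons_injective h))]

theorem anti_doubling (hτ : ∀ y, τ (τ y) = y) (u : List α) :
    anti τ (doubling τ u) = doubling τ u.reverse := by
  induction u with
  | nil => simp [anti]
  | cons y u ih =>
    by_cases hy : τ y = y
    · rw [doubling_cons_of_eq hy, ← List.singleton_append, anti_append, ih]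
      simp [anti, hy, doubling_cons_of_eq hy]
    · have e : doubling τ (y :: u) = [y, τ y] ++ doubling τ u := doubling_cons_of_ne hy u
      rw [e, anti_append, ih]
      simp [anti, hτ, doubling_cons_of_ne hy]

theorem count_anti (u : List α) (y : α) :
    (anti τ u).count (τ y) = u.count y := by
  rw [anti, List.count_reverse, List.count_map_of_injective _ _ τ.injective]

theorem count_of_anti_eq {u : List α} (hu : anti τ u = u) (y : α) :
    u.count (τ y) = u.count y := by
  rw [← count_anti u y, hu]

theorem count_doubling (hτ : ∀ y, τ (τ y) = y) (u : List α) (y : α) :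
    (doubling τ u).count (τ y) = (doubling τ u).count y := by
  induction u with
  | nil => simp
  | cons z u ih =>
    by_cases hz : τ z = z
    · rw [doubling_cons_of_eq hz, List.count_cons, List.count_cons, ih]
      have : z = τ y ↔ z = y := by
        constructor
        · intro h; rw [← hτ y, ← h, hz]
        · rintro rfl; exact hz.symm
      simp [this]
    · rw [doubling_cons_of_ne hz]
      simp only [List.count_cons, ih, beq_iff_eq]
      have h1 : τ z = τ y ↔ z = y := τ.injective.eq_iff
      have h2 : z = τ y ↔ τ z = y := by
        constructor
        · rintro rfl; exact hτ y
        · rintro rfl; exact (hτ z).symm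
      simp only [h1, h2]
      omega

/-- A cut falls either between two blocks or inside a block yτ(y). -/
theorem doubling_eq_append {u s q : List α} (h : s ++ q = doubling τ u) :
    (∃ s' q', s' ++ q' = u ∧ s = doubling τ s' ∧ q = doubling τ q') ∨
      ∃ s' y q', s' ++ y :: q' = u ∧ τ y ≠ y ∧ s = doubling τ s' ++ [y] ∧
        q = τ y :: doubling τ q' := by
  induction u generalizing s with
  | nil =>
    obtain ⟨rfl, rfl⟩ := List.append_eq_nil_iff.1 h
    exact Or.inl ⟨[], [], by simp⟩
  | cons y u ih =>
    cases s with
    | nil => exact Or.inl ⟨[], y :: u, by simp, by simp, by simpa using h⟩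
    | cons z s =>
      by_cases hy : τ y = y
      · rw [doubling_cons_of_eq hy, List.cons_append, List.cons.injEq] at h
        obtain ⟨rfl, h⟩ := h
        rcases ih h with ⟨s', q', rfl, rfl, rfl⟩ | ⟨s', t, q', rfl, ht, rfl, rfl⟩
        · exact Or.inl ⟨z :: s', q', by simp [doubling_cons_of_eq hy]⟩
        · exact Or.inr ⟨z :: s', t, q', by simp [doubling_cons_of_eq hy, ht]⟩
      · rw [doubling_cons_of_ne hy, List.cons_append, List.cons.injEq] at h
        obtain ⟨rfl, h⟩ := h
        cases s with
        | nil => exact Or.inr ⟨[], z, u, by simp, hy, by simp, by simpa using h⟩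
        | cons t s =>
          rw [List.cons_append, List.cons.injEq] at h
          obtain ⟨rfl, h⟩ := h
          rcases ih h with ⟨s', q', rfl, rfl, rfl⟩ | ⟨s', t, q', rfl, ht, rfl, rfl⟩
          · exact Or.inl ⟨z :: s', q', by simp [doubling_cons_of_ne hy]⟩
          · exact Or.inr ⟨z :: s', t, q', by simp [doubling_cons_of_ne hy, ht]⟩

theorem reverse_of_anti_doubling (hτ : ∀ y, τ (τ y) = y) {u : List α}
    (h : anti τ (doubling τ u) = doubling τ u) : u.reverse = u := by
  rw [anti_doubling hτ] at h
  exact doubling_injective h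

/-- Pseudopalindromic suffixes starting at a block boundary are the doublings of palindromic
suffixes; a letter count excludes all others. -/
theorem palClosure_doubling (hτ : ∀ y, τ (τ y) = y) (u : List α) :
    palClosure τ (doubling τ u) = doubling τ (palClosure 1 u) := by
  obtain ⟨s, p, rfl, hp, hmin⟩ := exists_longest_pal_suffix 1 u
  rw [palClosure_eq 1 hp hmin, doubling_append, palClosure_eq τ, anti_one, anti_doubling hτ]
  · simp
  · rw [anti_doubling hτ, ← anti_one, hp]
  · intro s' q' h hq'
    rw [← doubling_append] at h
    rcases doubling_eq_append h with ⟨s'', q'', h', rfl, rfl⟩ | ⟨s'', y, q'', h', hy, rfl, rfl⟩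
    · have h4 := hmin s'' q'' h' (by rw [anti_one, reverse_of_anti_doubling hτ hq'])
      exact (doubling_prefix (List.prefix_of_prefix_length_le (List.prefix_append _ _)
        ⟨_, h'⟩ h4)).length_le
    -- A split block leaves one surplus τ(y), whereas a pseudopalindrome contains y and τ(y) equally
    -- often.
    · exfalso
      have := count_of_anti_eq hq' y
      rw [List.count_cons, List.count_cons, count_doubling hτ] at this
      simp [hy] at this

/-- The lone final z has to be balanced by a lone τ(z) at the start. So the nonempty
pseudopalindromic suffixes come from palindromic suffixes z q z of uz, with the first block zτ(z)
cut in half. -/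
theorem palClosure_doubling_append_of_ne (hτ : ∀ y, τ (τ y) = y) {z : α} (hz : τ z ≠ z)
    (u : List α) :
    palClosure τ (doubling τ u ++ [z]) = doubling τ (palClosure 1 (u ++ [z])) := by
  obtain ⟨s, p, hsp, hp, hmin⟩ := exists_longest_pal_suffix 1 (u ++ [z])
  rw [hsp, palClosure_eq 1 hp hmin, anti_one]
  rw [← hsp] at hmin
  have hpne : p ≠ [] := by
    rintro rfl
    have := hmin u [z] rfl (by simp [anti])
    have h2 := congrArg List.length hsp
    simp at this h2
    omega
  rw [anti_one] at hp
  have hpl : p.getLast? = some z := by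
    have := congrArg List.getLast? hsp
    simpa [List.getLast?_append, hpne] using this.symm
  have hph : p.head? = some z := by
    rw [← hpl, ← List.head?_reverse, hp]
  obtain ⟨r, rfl⟩ : ∃ r, p = z :: r := by
    cases p with
    | nil => simp at hph
    | cons y p' => exact ⟨p', by simp_all⟩
  -- every nonempty pseudopalindromic suffix comes from a palindrome `z q' z`
  have key : ∀ s' q', s' ++ q' = doubling τ u ++ [z] → anti τ q' = q' → q' ≠ [] →
      ∃ s'' q'', s'' ++ z :: q'' = u ∧ s' = doubling τ s'' ++ [z] ∧ s.length ≤ s''.length := by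
    intro s' q' h hq' hne
    have hl : q'.getLast? = some z := by
      have := congrArg List.getLast? h
      rw [List.getLast?_concat] at this
      simpa [List.getLast?_append, hne] using this
    obtain ⟨q1, rfl⟩ : ∃ q1, q' = q1 ++ [z] := List.getLast?_eq_some_iff.1 hl
    have h1 : s' ++ q1 = doubling τ u := by
      rw [← List.append_assoc] at h
      exact List.append_cancel_right h
    rcases doubling_eq_append h1 with ⟨s'', q'', h', rfl, rfl⟩ | ⟨s'', y, q'', h', hy, rfl, rfl⟩
    · exfalso
      have := count_of_anti_eq hq' z
      rw [List.count_append, List.count_append, count_doubling hτ] at this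
      simp [hz.symm] at this
    · have e : anti τ (τ y :: doubling τ q'' ++ [z]) =
          τ z :: (anti τ (doubling τ q'') ++ [y]) := by
        simp [anti, hτ]
      rw [e, List.cons_append, List.cons.injEq] at hq'
      obtain ⟨h2, h3⟩ := hq'
      obtain rfl : z = y := τ.injective h2
      have h4 : anti τ (doubling τ q'') = doubling τ q'' := List.append_cancel_right h3
      have h5 : q''.reverse = q'' := reverse_of_anti_doubling hτ h4
      refine ⟨s'', q'', h', rfl, hmin s'' (z :: q'' ++ [z]) ?_ ?_⟩
      · rw [← h']; simp
      · rw [anti_one]; simp [h5]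
  rcases List.eq_nil_or_concat r with rfl | ⟨r, y, rfl⟩
  -- If the longest palindromic suffix is the single letter z, the longest pseudopalindromic suffix
  -- is empty.
  · obtain rfl : u = s := List.append_cancel_right hsp
    have e := palClosure_eq τ (s := doubling τ u ++ [z]) (q := []) (by simp [anti]) ?_
    · rw [List.append_nil] at e
      rw [e, anti_append, anti_doubling hτ]
      simp [anti, doubling_cons_of_ne hz]
    · intro s' q' h hq'
      rcases eq_or_ne q' [] with rfl | hne
      · have := congrArg List.length h
        simp at this ⊢
        omega
      · rw [List.append_nil] at h
        obtain ⟨s'', q'', h1, _, h3⟩ := key s' q' h hq' hne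
        have := congrArg List.length h1
        simp at this
        omega
  · obtain rfl : y = z := by
      rw [List.concat_eq_append, ← List.cons_append, List.getLast?_concat] at hpl
      simpa using hpl
    obtain rfl : s ++ y :: r = u := by
      have : u ++ [y] = (s ++ y :: r) ++ [y] := by simpa using hsp
      exact (List.append_cancel_right this).symm
    have hr : r.reverse = r := by simpa using hp
    have e : doubling τ (s ++ y :: r) ++ [y] =
        (doubling τ s ++ [y]) ++ (τ y :: doubling τ r ++ [y]) := by
      simp [doubling_cons_of_ne hz]
    rw [e, palClosure_eq τ, anti_append, anti_doubling hτ]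
    · simp [anti, doubling_cons_of_ne hz]
    · rw [anti_append, ← List.singleton_append (l := doubling τ r), anti_append,
        anti_doubling hτ, hr]
      simp [anti, hτ]
    · intro s' q' h hq'
      rcases eq_or_ne q' [] with rfl | hne
      · have := congrArg List.length h
        simp at this ⊢
        omega
      · obtain ⟨s'', q'', h1, rfl, h3⟩ := key s' q' (by rw [h, e]) hq' hne
        have := (doubling_prefix (τ := τ) (List.prefix_of_prefix_length_le
          (List.prefix_append _ _) ⟨_, h1⟩ h3)).length_le
        simpa using this

theorem Pal_eq_doubling (hτ : ∀ y, τ (τ y) = y) (u : List α) :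
    Pal τ u = doubling τ (Pal 1 u) := by
  induction u using List.reverseRecOn with
  | nil => rfl
  | append_singleton u z ih =>
    rw [Pal_append_singleton, Pal_append_singleton, ih]
    by_cases hz : τ z = z
    · rw [← palClosure_doubling hτ, doubling_append, doubling_cons_of_eq hz, doubling_nil]
    · exact palClosure_doubling_append_of_ne hτ hz _

end Doubling

end EpiWords

namespace EpiWords

variable {α : Type*} [DecidableEq α]

/-! ### Compositions of morphisms and length estimates -/

section Composition

/-- The composition `epi x₁ ∘ ⋯ ∘ epi x_k` for `v = x₁ ⋯ x_k`. -/
def epiComp (v u : List α) : List α := v.foldr epi u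

@[simp] theorem epiComp_nil_left (u : List α) : epiComp [] u = u := rfl

theorem epiComp_cons_left (x : α) (v u : List α) :
    epiComp (x :: v) u = epi x (epiComp v u) := rfl

theorem epiComp_append_left (v t u : List α) : epiComp (v ++ t) u = epiComp v (epiComp t u) := by
  simp [epiComp]

theorem epiComp_concat_left (v : List α) (x : α) (u : List α) :
    epiComp (v ++ [x]) u = epiComp v (epi x u) := epiComp_append_left _ _ _

@[simp] theorem epiComp_nil (v : List α) : epiComp v [] = [] := by
  induction v with
  | nil => rfl
  | cons x v ih => rw [epiComp_cons_left, ih, epi_nil]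

@[simp] theorem epiComp_append (v s t : List α) :
    epiComp v (s ++ t) = epiComp v s ++ epiComp v t := by
  induction v with
  | nil => rfl
  | cons x v ih => rw [epiComp_cons_left, ih, epi_append]; rfl

theorem Pal_one_append (v u : List α) : Pal 1 (v ++ u) = epiComp v (Pal 1 u) ++ Pal 1 v := by
  induction v with
  | nil => simp [Pal]
  | cons x v ih =>
    rw [List.cons_append, Pal_one_cons, Pal_one_cons, ih, epi_append, epiComp_cons_left]
    simp

theorem Pal_one_singleton (x : α) : Pal 1 [x] = [x] := by
  rw [Pal_one_cons]; simp [Pal]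

theorem length_Pal_one_concat (v : List α) (x : α) :
    (Pal 1 (v ++ [x])).length = (epiComp v [x]).length + (Pal 1 v).length := by
  rw [Pal_one_append, Pal_one_singleton]; simp

theorem epiComp_replicate (v : List α) (m : ℕ) (x : α) :
    epiComp v (List.replicate m x) = (List.replicate m (epiComp v [x])).flatten := by
  induction m with
  | zero => simp
  | succ m ih =>
    rw [List.replicate_succ, List.replicate_succ, List.flatten_cons, ← ih,
      ← List.singleton_append, epiComp_append]

theorem length_epiComp_replicate (v : List α) (m : ℕ) (x : α) :
    (epiComp v (List.replicate m x)).length = m * (epiComp v [x]).length := by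
  rw [epiComp_replicate]; simp

theorem epiComp_concat_self (v : List α) (x : α) : epiComp (v ++ [x]) [x] = epiComp v [x] := by
  simp [epiComp_concat_left]

theorem epiComp_concat_of_ne (v : List α) {x y : α} (h : y ≠ x) :
    epiComp (v ++ [x]) [y] = epiComp v [x] ++ epiComp v [y] := by
  rw [epiComp_concat_left, epi_cons_of_ne h, epi_nil, ← List.singleton_append, epiComp_append]

theorem length_epiComp_singleton_pos (v : List α) (x : α) : 0 < (epiComp v [x]).length := by
  induction v using List.reverseRecOn with
  | nil => simp
  | append_singleton v y ih =>
    by_cases h : x = y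
    · subst h; rwa [epiComp_concat_self]
    · rw [epiComp_concat_of_ne _ h, List.length_append]; omega

theorem length_Pal_one_add_two_le (v : List α) {x y : α} (h : x ≠ y) :
    (Pal 1 v).length + 2 ≤ (epiComp v [x]).length + (epiComp v [y]).length := by
  induction v using List.reverseRecOn with
  | nil => simp [Pal]
  | append_singleton v z ih =>
    have := length_epiComp_singleton_pos v z
    rw [length_Pal_one_concat]
    by_cases hx : x = z
    · subst hx
      rw [epiComp_concat_self, epiComp_concat_of_ne _ h.symm, List.length_append]
      omega
    · by_cases hy : y = z
      · subst hy
        rw [epiComp_concat_self, epiComp_concat_of_ne _ h, List.length_append]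
        omega
      · rw [epiComp_concat_of_ne _ hx, epiComp_concat_of_ne _ hy, List.length_append,
          List.length_append]
        omega

theorem length_epiComp_le_of_mem (v : List α) {x : α} {u : List α} (h : x ∈ u) :
    (epiComp v [x]).length ≤ (epiComp v u).length := by
  obtain ⟨s, t, rfl⟩ := List.append_of_mem h
  rw [← List.singleton_append (l := t), epiComp_append, epiComp_append, List.length_append,
    List.length_append]
  omega

theorem length_Pal_one_lt_of_mem (v : List α) {x y : α} {u : List α} (hx : x ∈ u) (hy : y ∈ u)
    (h : x ≠ y) : (Pal 1 v).length < (epiComp v u).length := by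
  have := length_Pal_one_add_two_le v h
  obtain ⟨s, t, rfl⟩ := List.append_of_mem hx
  have hy' : y ∈ s ∨ y ∈ t := by
    simpa [h.symm] using hy
  rw [← List.singleton_append (l := t), epiComp_append, epiComp_append, List.length_append,
    List.length_append]
  rcases hy' with hy' | hy'
  · have := length_epiComp_le_of_mem v hy'
    omega
  · have := length_epiComp_le_of_mem v hy'
    omega

/-- Appending x to v adds |ψ_v(x)| to |Pal(v)| and one to t, leaving ψ_v(x) unchanged. Appending
another letter resets t to 0, and `length_Pal_one_add_two_le` gives the bound. -/
theorem exists_replicate_suffix (v : List α) (x : α) : ∃ t, List.replicate t x <:+ v ∧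
    (Pal 1 v).length < (t + 2) * (epiComp v [x]).length := by
  induction v using List.reverseRecOn with
  | nil => exact ⟨0, by simp [Pal]⟩
  | append_singleton v y ih =>
    by_cases h : x = y
    · subst h
      obtain ⟨t, ⟨s, rfl⟩, h2⟩ := ih
      refine ⟨t + 1, ⟨s, by rw [List.replicate_succ', List.append_assoc]⟩, ?_⟩
      rw [length_Pal_one_concat, epiComp_concat_self]
      linarith
    · refine ⟨0, by simp, ?_⟩
      have := length_Pal_one_add_two_le v h
      have := length_epiComp_singleton_pos v x
      rw [length_Pal_one_concat, epiComp_concat_of_ne _ h, List.length_append]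
      omega

end Composition

/-! ### Runs of a letter -/

section Runs

theorem epi_replicate (x : α) (m : ℕ) : epi x (List.replicate m x) = List.replicate m x := by
  induction m with
  | zero => rfl
  | succ m ih => rw [List.replicate_succ, epi_cons_self, ih]

theorem unepi_replicate_succ (x : α) (m : ℕ) :
    unepi x (List.replicate (m + 1) x) = List.replicate m x := by
  have := unepi_epi x (List.replicate m x)
  rwa [epi_replicate, ← List.replicate_succ'] at this

/-- Desubstituting by x shortens a run of x by one. As soon as the directive word starts with y ≠ x,
x is isolated, which accounts for the extra 1. -/
theorem exists_replicate_prefix {δ : List α} {x : α} {m : ℕ}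
    (h : List.replicate m x <:+: Pal 1 δ) : ∃ r, List.replicate r x <+: δ ∧ m ≤ r + 1 := by
  induction δ generalizing m with
  | nil => 
    have := h.length_le
    simp [Pal] at this
    exact ⟨0, by simp, by omega⟩
  | cons y δ ih =>
    rw [Pal_one_cons] at h
    by_cases hxy : x = y
    · subst hxy
      cases m with
      | zero => exact ⟨0, by simp, by omega⟩
      | succ m =>
        have := unepi_infix (x := x) h
        rw [unepi_replicate_succ, unepi_epi] at this
        obtain ⟨r, h1, h2⟩ := ih this
        exact ⟨r + 1, by simpa [List.replicate_succ] using h1, by omega⟩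
    · refine ⟨0, by simp, ?_⟩
      by_contra! hm
      obtain ⟨m, rfl⟩ := Nat.exists_eq_add_of_le hm
      have h1 : Separated y (List.replicate (0 + 1 + 1 + m) x) := (separated_epi y _).infix h
      rw [Nat.add_comm, List.replicate_succ, List.replicate_succ] at h1
      simp [hxy] at h1

/-- Every run of a letter in `u` has length at most `l`. -/
def RunsLE (l : ℕ) (u : List α) : Prop := ∀ x m, List.replicate m x <:+: u → m ≤ l

omit [DecidableEq α] in
theorem RunsLE.infix {l : ℕ} {u v : List α} (h : RunsLE l v) (huv : u <:+: v) : RunsLE l u :=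
  fun x m hm => h x m (hm.trans huv)

end Runs

/-! ### Upper bound on powers -/

section PowerFree

omit [DecidableEq α] in
theorem eq_replicate_of_prefix_append {x : α} {i : ℕ} {z : List α}
    (h : z <+: List.replicate (i + 1) x ++ z) : z = List.replicate z.length x := by
  induction z with
  | nil => rfl
  | cons y z ih =>
    rw [List.replicate_succ, List.cons_append, List.cons_prefix_cons] at h
    obtain ⟨rfl, h⟩ := h
    have : z = List.replicate z.length y := by
      apply ih
      rwa [List.replicate_succ', List.append_assoc]
    rw [List.length_cons, List.replicate_succ, ← this]

theorem exists_eq_append_of_length_le {v u z : List α} (hz : z <+: u ++ z)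
    (h : (epiComp v u).length < (epiComp v z).length) : ∃ z', z = u ++ z' ∧ z' <+: u ++ z' := by
  rcases List.prefix_or_prefix_of_prefix hz (List.prefix_append u z) with h1 | ⟨z', rfl⟩
  · obtain ⟨t, rfl⟩ := h1
    rw [epiComp_append, List.length_append] at h
    omega
  · exact ⟨z', rfl, (List.prefix_append_right_inj u).1 hz⟩

/-- Decoding loses at most a final x, hence the error term |ψ_v(x)|. -/
theorem length_epiComp_le (v : List α) {q u : List α} {x : α} (h : u <:+: epi x q ++ [x])
    (hh : u.head? = some x) :
    (epiComp v u).length ≤ (epiComp (v ++ [x]) (unepi x u)).length + (epiComp v [x]).length := by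
  have hs : Separated x u := (separated_epi x q).infix h
  rw [epiComp_concat_left]
  rcases List.eq_nil_or_concat u with rfl | ⟨t, y, rfl⟩
  · simp
  · rw [List.concat_eq_append] at *
    by_cases hy : y = x
    · subst hy
      rw [epi_unepi hs hh, epiComp_append, List.length_append]
    · have h1 : Separated x (t ++ [y] ++ [x]) := by
        refine List.isChain_append.2 ⟨hs, by simp, fun _ _ z hz => Or.inr ?_⟩
        simpa using hz.symm
      have h2 : (t ++ [y] ++ [x]).head? = some x := by
        rw [List.head?_append, hh]; rfl
      have h3 := epi_unepi h1 h2
      have h4 : unepi x (t ++ [y] ++ [x]) = unepi x (t ++ [y]) := by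
        clear hs hh h h1 h2 h3
        induction t with
        | nil => simp [unepi_cons_of_ne hy]
        | cons w t ih =>
          have : (t ++ [y] ++ [x]).head? = (t ++ [y]).head? := by cases t <;> simp
          rw [List.cons_append, List.cons_append, unepi_cons, this, ih, ← unepi_cons]
      rw [h4] at h3
      rw [h3]
      omega

/-- Here z is a power of x with |z| ≤ r+1, x^r being a prefix of δ, and |Pal(v)| < (t+2)|ψ_v(x)|
with x^t a suffix of v. Since t+r ≤ l, the right side of `hlen` is below (l+3)|ψ_v(x)|. -/
theorem replicate_factor_false {l : ℕ} {v δ z : List α} {x : α} {i : ℕ}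
    (hl : RunsLE l (v ++ δ)) (hz : z <:+: Pal 1 δ) (hp : z <+: List.replicate (i + 1) x ++ z)
    (hlen : (l + 3) * (epiComp v (List.replicate (i + 1) x)).length ≤
      (epiComp v z).length + (Pal 1 v).length) : False := by
  rw [eq_replicate_of_prefix_append hp] at hz hlen
  obtain ⟨r, ⟨δ', rfl⟩, hr⟩ := exists_replicate_prefix hz
  obtain ⟨t, ⟨v', rfl⟩, ht⟩ := exists_replicate_suffix v x
  have h1 : t + r ≤ l := hl x (t + r) ⟨v', δ', by
    rw [List.replicate_add]; simp only [List.append_assoc]⟩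
  rw [length_epiComp_replicate, length_epiComp_replicate] at hlen
  set h := (epiComp (v' ++ List.replicate t x) [x]).length
  have h2 : z.length * h ≤ (r + 1) * h := Nat.mul_le_mul_right _ hr
  have h3 : (l + 3) * h ≤ (l + 3) * ((i + 1) * h) :=
    Nat.mul_le_mul_left _ (Nat.le_mul_of_pos_left _ (Nat.succ_pos i))
  have h4 : (t + r + 3) * h ≤ (l + 3) * h := Nat.mul_le_mul_right _ (by omega)
  have h5 : (t + r + 3) * h = (r + 1) * h + (t + 2) * h := by ring
  omega

/-- Desubstitution of a periodic factor whose period starts with the letter `x`. -/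
theorem exists_unepi_periodic (v : List α) {q u z : List α} {x : α} (hz : z <:+: epi x q ++ [x])
    (hh : u.head? = some x) (hp : z <+: u ++ z) (hu : u ++ [x] <+: z) :
    ∃ u' z', u' ≠ [] ∧ z' <:+: q ∧ z' <+: u' ++ z' ∧
      (epiComp (v ++ [x]) u').length = (epiComp v u).length ∧
      (epiComp v z).length + (Pal 1 v).length ≤
        (epiComp (v ++ [x]) z').length + (Pal 1 (v ++ [x])).length := by
  have hne : u ≠ [] := by rintro rfl; simp at hh
  have hzh : z.head? = some x := by
    obtain ⟨t, rfl⟩ := hu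
    simp [List.head?_append, hh]
  have hux : (u ++ [x]).head? = some x := by simp [List.head?_append, hh]
  have hsu : Separated x (u ++ [x]) := (separated_epi x q).infix (hu.isInfix.trans hz)
  have he := epi_unepi hsu hux
  refine ⟨unepi x (u ++ [x]), unepi x z, ?_, ?_, ?_, ?_, ?_⟩
  · intro h
    rw [h] at he
    exact hne he.symm
  · have := unepi_infix (x := x) hz
    rwa [unepi_epi] at this
  · have := unepi_prefix (x := x) hp
    obtain ⟨t, rfl⟩ : ∃ t, z = x :: t := by
      cases z with
      | nil => simp at hzh
      | cons y t => exact ⟨t, by simp_all⟩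
    rwa [unepi_append_cons] at this
  · rw [epiComp_concat_left, he]
  -- The possible loss |ψ_v(x)| is exactly the growth from |Pal(v)| to |Pal(vx)|.
  · have := length_epiComp_le v hz hzh
    rw [length_Pal_one_concat]
    omega

/-- A periodic factor may be rotated so that its period starts with the separating letter. -/
theorem exists_rotate_periodic (v : List α) {q u z : List α} {x : α} (hz : z <:+: epi x q ++ [x])
    (hne : u ≠ []) (hp : z <+: u ++ z) (hu : u ++ u <+: z) :
    ∃ u' z', z' <:+: epi x q ++ [x] ∧ u'.head? = some x ∧ z' <+: u' ++ z' ∧ u' ++ [x] <+: z' ∧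
      (epiComp v u').length = (epiComp v u).length ∧
      (epiComp v z).length ≤ (epiComp v z').length := by
  have hsep := separated_epi x q
  obtain ⟨y, u0, rfl⟩ := List.exists_cons_of_ne_nil hne
  by_cases hy : y = x
  · subst hy
    refine ⟨y :: u0, z, hz, rfl, hp, ?_, rfl, le_rfl⟩
    obtain ⟨t, rfl⟩ := hu
    exact ⟨u0 ++ t, by simp⟩
  obtain ⟨u1, w, hw⟩ : ∃ u1 w, y :: u0 = u1 ++ [w] := by
    rcases List.eq_nil_or_concat (y :: u0) with h | ⟨u1, w, h⟩
    · simp at h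
    · exact ⟨u1, w, by simpa using h⟩
  -- The junction of uu shows w followed by y ≠ x, so separation forces w to be x.
  obtain rfl : w = x := by
    have h1 : [w, y] <:+: epi x q ++ [x] := by
      refine List.IsInfix.trans ?_ (hu.isInfix.trans hz)
      refine ⟨u1, u0, ?_⟩
      rw [List.append_cons (as := (y :: u0)), ← List.append_cons, hw]
      simp only [List.append_assoc, List.cons_append, List.nil_append]
      rw [← hw]
    have h2 : Separated x [w, y] := hsep.infix h1
    simpa [hy] using h2
  have hyz : ∃ z0, z = y :: z0 := by
    obtain ⟨t, rfl⟩ := hu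
    exact ⟨_, rfl⟩
  obtain ⟨z0, rfl⟩ := hyz
  -- The ambient word begins with the separating letter, so z is not at its start and is preceded by
  -- that letter.
  have hxz : w :: y :: z0 <:+: epi w q ++ [w] := by
    obtain ⟨s, t, hst⟩ := hz
    rcases List.eq_nil_or_concat s with rfl | ⟨s, w', rfl⟩
    · have h1 := head?_epi_append_cons w q []
      rw [← hst] at h1
      simp [hy] at h1
    · have h1 : [w', y] <:+: epi w q ++ [w] := ⟨s, z0 ++ t, by rw [← hst]; simp⟩
      have h2 : Separated w [w', y] := hsep.infix h1
      obtain rfl : w' = w := by simpa [hy] using h2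
      exact ⟨s, t, by rw [← hst]; simp⟩
  refine ⟨w :: u1, w :: y :: z0, hxz, rfl, ?_, ?_, ?_, ?_⟩
  · rw [hw] at hp
    simpa using hp
  · rw [List.cons_append, ← hw, List.prefix_cons_inj]
    exact (List.prefix_append _ _).trans hu
  · rw [hw, ← List.singleton_append, epiComp_append, epiComp_append, List.length_append,
      List.length_append, Nat.add_comm]
  · rw [← List.singleton_append (l := y :: z0), epiComp_append, List.length_append]
    omega

/-- Two distinct letters in u give |Pal(v)| < |ψ_v(u)|, so ψ_v(z) is longer than two copies of
ψ_v(u). -/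
theorem append_self_prefix {l : ℕ} {v u z : List α} (hconst : ¬∃ y, ∀ y' ∈ u, y' = y)
    (hp : z <+: u ++ z)
    (hlen : (l + 3) * (epiComp v u).length ≤ (epiComp v z).length + (Pal 1 v).length) :
    u ++ u <+: z := by
  rcases u with _ | ⟨y, u⟩
  · simp
  push Not at hconst
  obtain ⟨y', hy', hyy'⟩ := hconst y
  have hlt := length_Pal_one_lt_of_mem v hy' List.mem_cons_self hyy'
  have hexp : (l + 3) * (epiComp v (y :: u)).length = l * (epiComp v (y :: u)).length +
    3 * (epiComp v (y :: u)).length := by ring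
  obtain ⟨z1, rfl, hz1⟩ := exists_eq_append_of_length_le (v := v) hp (by omega)
  rw [epiComp_append, List.length_append] at hlen
  obtain ⟨z2, rfl, -⟩ := exists_eq_append_of_length_le (v := v) hz1 (by omega)
  exact ⟨z2, by simp⟩

/-- The prefix v is kept so that the induction on δ can still see runs straddling v and δ. -/
theorem periodic_factor_false {l : ℕ} (v δ u z : List α) (hl : RunsLE l (v ++ δ)) (hne : u ≠ [])
    (hz : z <:+: Pal 1 δ) (hp : z <+: u ++ z)
    (hlen : (l + 3) * (epiComp v u).length ≤ (epiComp v z).length + (Pal 1 v).length) : False := by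
  induction δ generalizing v u z with
  | nil =>
    obtain rfl : z = [] := by simpa [Pal] using hz
    obtain ⟨x, u, rfl⟩ := List.exists_cons_of_ne_nil hne
    by_cases hconst : ∃ y, ∀ y' ∈ x :: u, y' = y
    · obtain ⟨y, hy⟩ := hconst
      have h1 := List.eq_replicate_of_mem hy
      rw [h1] at hp hlen
      exact replicate_factor_false hl hz hp hlen
    · simpa using append_self_prefix hconst hp hlen
  | cons x δ ih =>
    by_cases hconst : ∃ y, ∀ y' ∈ u, y' = y
    · obtain ⟨y, hy⟩ := hconst
      have h1 := List.eq_replicate_of_mem hy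
      obtain ⟨i, hi⟩ : ∃ i, u.length = i + 1 :=
        Nat.exists_eq_succ_of_ne_zero (by simpa using hne)
      rw [h1, hi] at hp hlen
      exact replicate_factor_false hl hz hp hlen
    · have huu := append_self_prefix hconst hp hlen
      rw [Pal_one_cons] at hz
      obtain ⟨u', z', h1, h2, h3, h4, h5, h6⟩ := exists_rotate_periodic v hz hne hp huu
      obtain ⟨u'', z'', k1, k2, k3, k4, k5⟩ := exists_unepi_periodic v h1 h2 h3 h4
      refine ih (v ++ [x]) u'' z'' (by simpa using hl) k1 k2 k3 ?_
      rw [k4, h5]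
      omega

omit [DecidableEq α] in
theorem flatten_replicate_prefix (k : ℕ) (u : List α) :
    (List.replicate k u).flatten <+: u ++ (List.replicate k u).flatten := by
  rw [← List.flatten_cons, ← List.replicate_succ, List.replicate_succ']
  simp

/-- A directive word whose runs have length at most `l` yields no `(l + 3)`-th power. -/
theorem power_not_infix {l : ℕ} {δ u : List α} (hl : RunsLE l δ) (hu : u ≠ []) :
    ¬ (List.replicate (l + 3) u).flatten <:+: Pal 1 δ := fun h =>
  periodic_factor_false [] δ u _ hl hu h (flatten_replicate_prefix _ _) (by simp)

end PowerFree

/-! ### Lower bound on powers -/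

section Powers

theorem epi_append_prefix {x : α} {u v : List α} (h : u <+: v) :
    epi x u ++ [x] <+: epi x v ++ [x] := by
  obtain ⟨t, rfl⟩ := h
  rw [epi_append, List.append_assoc, List.prefix_append_right_inj]
  cases t with
  | nil => simp
  | cons y t => by_cases h : y = x <;> simp [epi_cons, h]

theorem Pal_one_prefix_epiComp (v u : List α) : Pal 1 v <+: epiComp v u ++ Pal 1 v := by
  induction v with
  | nil => simp [Pal]
  | cons x v ih =>
    have := epi_append_prefix (x := x) ih
    rw [Pal_one_cons, epiComp_cons_left, ← List.append_assoc, ← epi_append]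
    exact this

theorem epiComp_singleton_of_notMem {v : List α} {x : α} (h : x ∉ v) :
    epiComp v [x] = Pal 1 v ++ [x] := by
  induction v with
  | nil => simp [Pal]
  | cons y v ih =>
    rw [List.mem_cons, not_or] at h
    rw [epiComp_cons_left, ih h.2, Pal_one_cons, epi_append, epi_cons_of_ne h.1]
    simp

/-- After the last occurrence of x in v, say in xv₂, one has ψ_{xv₂}(x) = Pal(xv₂), a prefix of
every ψ_{xv₂}(u)Pal(xv₂). -/
theorem epiComp_singleton_prefix {v : List α} {x : α} (h : x ∈ v) (u : List α) :
    epiComp v [x] <+: epiComp v u ++ Pal 1 v := by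
  induction v with
  | nil => simp at h
  | cons y v ih =>
    have e : epiComp (y :: v) u ++ Pal 1 (y :: v) = epi y (epiComp v u ++ Pal 1 v) ++ [y] := by
      rw [Pal_one_cons, epiComp_cons_left, epi_append, List.append_assoc]
    rw [e, epiComp_cons_left]
    by_cases hv : x ∈ v
    · exact (List.prefix_append _ _).trans (epi_append_prefix (ih hv))
    · obtain rfl : x = y := by simpa [hv] using h
      rw [epiComp_singleton_of_notMem hv, epi_append, epi_cons_self, epi_nil]
      exact epi_append_prefix (Pal_one_prefix_epiComp v u)

theorem mem_Pal_one {u : List α} {x : α} : x ∈ Pal 1 u ↔ x ∈ u := by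
  induction u with
  | nil => simp [Pal]
  | cons y u ih =>
    rw [Pal_one_cons, List.mem_cons, ← ih]
    simp only [epi, List.mem_append, List.mem_flatMap, List.mem_singleton]
    constructor
    · rintro (⟨z, hz, hx⟩ | h)
      · split_ifs at hx with h
        · simp_all
        · simp only [List.mem_cons, List.not_mem_nil, or_false] at hx
          rcases hx with rfl | rfl <;> simp_all
      · exact Or.inl h
    · rintro (h | h)
      · exact Or.inr h
      · refine Or.inl ⟨x, h, ?_⟩
        split_ifs with h' <;> simp [h']

theorem exists_epi_append_eq_cons (x : α) (q : List α) : ∃ q', epi x q ++ [x] = x :: q' ∧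
    ((∃ y ∈ q, y ≠ x) → (∃ y ∈ q', y ≠ x) ∧ x ∈ q') := by
  induction q with
  | nil => exact ⟨[], by simp⟩
  | cons y q ih =>
    obtain ⟨q', h1, h2⟩ := ih
    by_cases hy : y = x
    · subst hy
      refine ⟨y :: q', by rw [epi_cons_self, List.cons_append, h1], ?_⟩
      rintro ⟨z, hz, hzy⟩
      have hz' : z ∈ q := by simpa [hzy] using hz
      obtain ⟨⟨w, hw, hwy⟩, -⟩ := h2 ⟨z, hz', hzy⟩
      exact ⟨⟨w, List.mem_cons_of_mem _ hw, hwy⟩, List.mem_cons_self⟩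
    · refine ⟨y :: x :: q', ?_, fun _ => ⟨⟨y, List.mem_cons_self, hy⟩, by simp⟩⟩
      rw [epi_cons_of_ne hy, List.cons_append, List.cons_append, h1]

theorem mem_epi {x : α} {p : List α} (h : p ≠ []) : x ∈ epi x p := by
  obtain ⟨y, p, rfl⟩ := List.exists_cons_of_ne_nil h
  by_cases hy : y = x <;> simp [epi_cons, hy]

theorem Pal_one_replicate_append {x : α} {t p₀ q₀ : List α} (h : Pal 1 t = p₀ ++ x :: q₀)
    (m : ℕ) : ∃ p q, Pal 1 (List.replicate m x ++ t) = p ++ List.replicate (m + 1) x ++ q ∧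
      (p₀ ≠ [] → p ≠ [] ∧ (0 < m → x ∈ p)) ∧
      ((∃ y ∈ q₀, y ≠ x) → (∃ y ∈ q, y ≠ x) ∧ (0 < m → x ∈ q)) := by
  induction m with
  | zero => exact ⟨p₀, q₀, by simpa using h, by simp, by simp⟩
  | succ m ih =>
    obtain ⟨p, q, h1, h2, h3⟩ := ih
    obtain ⟨q', h4, h5⟩ := exists_epi_append_eq_cons x q
    refine ⟨epi x p, q', ?_, fun hp => ?_, fun hq => ?_⟩
    · rw [List.replicate_succ, List.cons_append, Pal_one_cons, h1, epi_append, epi_append,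
        epi_replicate, List.append_assoc, h4, List.replicate_succ' (n := m + 1)]
      simp
    · have := mem_epi (x := x) (h2 hp).1
      exact ⟨List.ne_nil_of_mem this, fun _ => this⟩
    · have := h5 (h3 hq).1
      exact ⟨this.1, fun _ => this.2⟩

/-- Each letter of x^m lengthens by one a run of x in Pal(t), giving x^(m+1). Its image is a power
of ψ_v(x), and what follows begins with one more copy because x occurs in v. -/
theorem power_infix {x : α} {m : ℕ} {v t : List α} (hv : x ∈ v) (ht : x ∈ t) :
    (List.replicate (m + 2) (epiComp v [x])).flatten <:+:
      Pal 1 (v ++ List.replicate m x ++ t) := by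
  obtain ⟨p₀, q₀, h₀⟩ := List.append_of_mem (mem_Pal_one.2 ht)
  obtain ⟨p, q, h, -⟩ := Pal_one_replicate_append h₀ m
  obtain ⟨r, hr⟩ := epiComp_singleton_prefix hv q
  refine ⟨epiComp v p, r, ?_⟩
  rw [List.append_assoc v, Pal_one_append, h, epiComp_append, epiComp_append, List.append_assoc,
    List.append_assoc, List.append_assoc, ← hr, epiComp_replicate, List.replicate_succ' (n := m + 1)]
  simp

end Powers

end EpiWords

namespace EpiWords

variable {α : Type*}

/-! ### Infinite words as limits of prefixes -/

section Limits

theorem getElem?_block (w : ℕ → α) (i m k : ℕ) :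
    (block w i m)[k]? = if k < m then some (w (i + k)) else none := by
  unfold block
  split_ifs with h
  · simp [h]
  · simpa using h

@[simp] theorem length_block (w : ℕ → α) (i m : ℕ) : (block w i m).length = m := by
  simp [block]

theorem block_add (w : ℕ → α) (i m k : ℕ) : block w i (m + k) = block w i m ++ block w (i + m) k := by
  simp [block, List.range_add, Function.comp_def, Nat.add_assoc]

theorem block_succ (w : ℕ → α) (m : ℕ) : block w 0 (m + 1) = block w 0 m ++ [w m] := by
  simp [block, List.range_succ]

theorem block_prefix_block (w : ℕ → α) {m k : ℕ} (h : m ≤ k) : block w 0 m <+: block w 0 k := by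
  obtain ⟨d, rfl⟩ := Nat.exists_eq_add_of_le h
  rw [block_add]
  exact List.prefix_append _ _

theorem exists_limitWord {f : ℕ → List α} (h : ∀ i, f i <+: f (i + 1))
    (hl : ∀ i, i ≤ (f i).length) :
    ∃ w, (∀ i, block w 0 (f i).length = f i) ∧ IsLimitWord f w := by
  have hmono : ∀ i j, i ≤ j → f i <+: f j := by
    intro i j hij
    induction j, hij using Nat.le_induction with
    | base => exact List.prefix_rfl
    | succ j _ ih => exact ih.trans (h j)
  have hlt : ∀ k, k < (f (k + 1)).length := fun k => hl (k + 1)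
  have key : ∀ i k, k < (f i).length → (f i)[k]? = some ((f (k + 1))[k]'(hlt k)) := by
    intro i k hk
    rcases le_total i (k + 1) with hik | hik
    · rw [List.getElem?_eq_getElem hk]
      exact congrArg some ((hmono _ _ hik).getElem hk)
    · rw [List.getElem?_eq_getElem hk]
      exact congrArg some ((hmono _ _ hik).getElem (hlt k)).symm
  refine ⟨fun k => (f (k + 1))[k]'(hlt k), fun i => ?_, fun k => ?_⟩
  · apply List.ext_getElem?
    intro k
    rw [getElem?_block]
    split_ifs with hk
    · rw [key i k hk, Nat.zero_add]
    · rw [eq_comm, List.getElem?_eq_none_iff]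
      omega
  · filter_upwards [eventually_ge_atTop (k + 1)] with i hi
    exact key i k (lt_of_lt_of_le (Nat.lt_of_succ_le hi) (hl i))

theorem isFactor_iff {w : ℕ → α} {f : ℕ → List α} (hl : ∀ i, i ≤ (f i).length)
    (hw : ∀ i, block w 0 (f i).length = f i) (v : List α) :
    IsFactor v w ↔ ∃ i, v <:+: f i := by
  constructor
  · rintro ⟨i, hi⟩
    refine ⟨i + v.length, ?_⟩
    rw [← hw]
    refine List.IsInfix.trans ?_ (block_prefix_block w (hl _)).isInfix
    rw [block_add, Nat.zero_add, hi]
    exact (List.suffix_append _ _).isInfix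
  · rintro ⟨i, s, t, hst⟩
    refine ⟨s.length, ?_⟩
    have h := hw i
    rw [← hst, List.length_append, List.length_append, block_add, block_add] at h
    have h1 := (List.append_inj h (by simp)).1
    have h2 := (List.append_inj h1 (by simp)).2
    simpa using h2

end Limits

/-! ### The hybrid directive word -/

section Hybrid

variable [DecidableEq α]

theorem replicate_infix_of_replicate_infix_doubling {τ : Equiv.Perm α} {x : α} (hx : τ x = x)
    {m : ℕ} {u : List α} (h : List.replicate m x <:+: doubling τ u) :
    List.replicate m x <:+: u := by
  have hpre : ∀ (m : ℕ) (u : List α), List.replicate m x <+: doubling τ u →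
      List.replicate m x <+: u := by
    intro m u h
    induction m generalizing u with
    | zero => simp
    | succ m ih =>
      rw [List.replicate_succ] at h ⊢
      cases u with
      | nil => simp at h
      | cons y u =>
        by_cases hy : τ y = y
        · rw [doubling_cons_of_eq hy, List.cons_prefix_cons] at h
          exact List.cons_prefix_cons.2 ⟨h.1, ih u h.2⟩
        · rw [doubling_cons_of_ne hy, List.cons_prefix_cons] at h
          exact absurd (h.1 ▸ hx) hy
  induction u with
  | nil => simpa using h
  | cons y u ih =>
    have h0 := hpre m (y :: u)
    by_cases hy : τ y = y
    · rw [doubling_cons_of_eq hy] at h h0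
      rcases List.infix_cons_iff.1 h with h | h
      · exact (h0 h).isInfix
      · exact (ih h).trans (List.suffix_cons _ _).isInfix
    · rw [doubling_cons_of_ne hy] at h h0
      rcases List.infix_cons_iff.1 h with h | h
      · exact (h0 h).isInfix
      · rcases List.infix_cons_iff.1 h with h | h
        · cases m with
          | zero => simp
          | succ m =>
            rw [List.replicate_succ, List.cons_prefix_cons] at h
            rw [← h.1] at hy
            exact absurd (τ.injective (h.1 ▸ hx)) (h.1 ▸ hy)
        · exact (ih h).trans (List.suffix_cons _ _).isInfix

/-- In xxx, one of the first two letters would start a block, but no block boundary is followed by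
xx. -/
theorem le_two_of_replicate_infix_doubling {τ : Equiv.Perm α} {x : α} (hx : τ x ≠ x)
    {m : ℕ} {u : List α} (h : List.replicate m x <:+: doubling τ u) : m ≤ 2 := by
  by_contra! hm
  obtain ⟨m, rfl⟩ := Nat.exists_eq_add_of_le' hm
  have h3 : [x, x, x] <:+: doubling τ u := by
    refine List.IsInfix.trans ⟨[], List.replicate m x, ?_⟩ h
    simp [List.replicate_succ]
  clear h hm
  have hpre : ∀ (u : List α), ¬ [x, x] <+: doubling τ u := by
    intro u h
    cases u with
    | nil => simp at h
    | cons y u =>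
      by_cases hy : τ y = y
      · rw [doubling_cons_of_eq hy, List.cons_prefix_cons] at h
        exact hx (h.1 ▸ hy)
      · rw [doubling_cons_of_ne hy, List.cons_prefix_cons, List.cons_prefix_cons] at h
        exact hx (by rw [h.1, ← h.2.1, h.1])
  have hpre3 : ∀ (u : List α), ¬ [x, x, x] <+: doubling τ u := fun u h =>
    hpre u (List.IsPrefix.trans ⟨[x], rfl⟩ h)
  induction u with
  | nil => simp at h3
  | cons y u ih =>
    have h0 := hpre3 (y :: u)
    by_cases hy : τ y = y
    · rw [doubling_cons_of_eq hy] at h3 h0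
      rcases List.infix_cons_iff.1 h3 with h | h
      · exact h0 h
      · exact ih h
    · rw [doubling_cons_of_ne hy] at h3 h0
      rcases List.infix_cons_iff.1 h3 with h | h
      · exact h0 h
      · rcases List.infix_cons_iff.1 h with h | h
        · exact hpre u (List.cons_prefix_cons.1 h).2
        · exact ih h

theorem mem_doubling {τ : Equiv.Perm α} {x : α} {u : List α} (h : x ∈ doubling τ u) :
    ∃ y ∈ u, x = y ∨ x = τ y := by
  obtain ⟨y, hy, hx⟩ := List.mem_flatMap.1 h
  refine ⟨y, hy, ?_⟩
  split_ifs at hx <;> simp_all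

theorem mem_doubling_of_mem {τ : Equiv.Perm α} {x : α} {u : List α} (h : x ∈ u) :
    x ∈ doubling τ u := by
  refine List.mem_flatMap.2 ⟨x, h, ?_⟩
  split_ifs <;> simp

theorem doubling_replicate {τ : Equiv.Perm α} {x : α} (hx : τ x = x) (m : ℕ) :
    doubling τ (List.replicate m x) = List.replicate m x := by
  induction m with
  | zero => rfl
  | succ m ih => rw [List.replicate_succ, doubling_cons_of_eq hx, ih]

theorem reverse_Pal_one (u : List α) : (Pal 1 u).reverse = Pal 1 u := by
  induction u with
  | nil => rfl
  | cons x u ih => rw [Pal_one_cons, reverse_epi_append, ih]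

theorem Pal_one_replicate (m : ℕ) (x : α) : Pal 1 (List.replicate m x) = List.replicate m x := by
  induction m with
  | zero => rfl
  | succ m ih =>
    rw [List.replicate_succ, Pal_one_cons, ih, epi_replicate, ← List.replicate_succ',
      List.replicate_succ]

theorem anti_Pal {τ : Equiv.Perm α} (hτ : ∀ y, τ (τ y) = y) (u : List α) :
    anti τ (Pal τ u) = Pal τ u := by
  rw [Pal_eq_doubling hτ, anti_doubling hτ, reverse_Pal_one]

/-- The words whose limit is the hybrid fixed word. -/
noncomputable def hybrid (n : ℕ) (a b c : α) (i : ℕ) : List α :=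
  (Pal (Equiv.swap b c))^[i] (List.replicate n a ++ [b])

variable {a b c : α} {n : ℕ}

theorem hybrid_succ (n : ℕ) (a b c : α) (i : ℕ) :
    hybrid n a b c (i + 1) = Pal (Equiv.swap b c) (hybrid n a b c i) :=
  Function.iterate_succ_apply' _ _ _

theorem hybrid_succ_eq_doubling (n : ℕ) (a b c : α) (i : ℕ) :
    hybrid n a b c (i + 1) = doubling (Equiv.swap b c) (Pal 1 (hybrid n a b c i)) := by
  rw [hybrid_succ, Pal_eq_doubling (fun y => Equiv.swap_apply_self b c y)]

theorem swap_apply_fixed (hab : a ≠ b) (hac : a ≠ c) : Equiv.swap b c a = a :=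
  Equiv.swap_apply_of_ne_of_ne hab hac

theorem hybrid_one_prefix (hab : a ≠ b) (hac : a ≠ c) (hbc : b ≠ c) (n : ℕ) :
    List.replicate n a ++ [b, c] <+: hybrid n a b c 1 := by
  have h := append_singleton_prefix_Pal 1 (List.replicate n a) b
  rw [Pal_one_replicate] at h
  have h2 := doubling_prefix (τ := Equiv.swap b c) h
  rw [doubling_append, doubling_replicate (swap_apply_fixed hab hac),
    doubling_cons_of_ne (by simpa using hbc.symm)] at h2
  rw [hybrid_succ_eq_doubling]
  simpa [hybrid] using h2

theorem hybrid_prefix_succ (hab : a ≠ b) (hac : a ≠ c) (hbc : b ≠ c) (n i : ℕ) :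
    ∃ t, t ≠ [] ∧ hybrid n a b c (i + 1) = hybrid n a b c i ++ t := by
  induction i with
  | zero =>
    obtain ⟨t, ht⟩ := hybrid_one_prefix hab hac hbc n
    refine ⟨c :: t, by simp, ?_⟩
    rw [← ht]
    simp [hybrid]
  | succ i ih =>
    obtain ⟨t, ht, h⟩ := ih
    obtain ⟨⟨r, hr⟩, h2⟩ := Pal_prefix_append (Equiv.swap b c) (hybrid n a b c i) t
    rw [← h, ← hybrid_succ, ← hybrid_succ] at hr h2
    refine ⟨r, ?_, hr.symm⟩
    rintro rfl
    rw [← hr, List.append_nil] at h2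
    have := List.length_pos_iff.2 ht
    omega

theorem le_length_hybrid (hab : a ≠ b) (hac : a ≠ c) (hbc : b ≠ c) (n i : ℕ) :
    i ≤ (hybrid n a b c i).length := by
  induction i with
  | zero => simp
  | succ i ih =>
    obtain ⟨t, ht, h⟩ := hybrid_prefix_succ hab hac hbc n i
    have := List.length_pos_iff.2 ht
    rw [h, List.length_append]
    omega

theorem hybrid_prefix_add (hab : a ≠ b) (hac : a ≠ c) (hbc : b ≠ c) (n i j : ℕ) :
    hybrid n a b c i <+: hybrid n a b c (i + j) := by
  induction j with
  | zero => exact List.prefix_rfl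
  | succ j ih =>
    obtain ⟨t, -, h⟩ := hybrid_prefix_succ hab hac hbc n (i + j)
    exact ih.trans ⟨t, h.symm⟩

/-- The iterate is a pseudopalindrome beginning with a^n bc, whose image under the antimorphism is
bca^n. -/
theorem hybrid_suffix (hab : a ≠ b) (hac : a ≠ c) (hbc : b ≠ c) (n i : ℕ) :
    [b, c] ++ List.replicate n a <:+ hybrid n a b c (i + 1) := by
  have h := (hybrid_one_prefix hab hac hbc n).trans (hybrid_prefix_add hab hac hbc n 1 i)
  rw [Nat.add_comm] at h
  obtain ⟨t, ht⟩ := h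
  refine ⟨anti (Equiv.swap b c) t, ?_⟩
  have h2 := anti_Pal (fun y => Equiv.swap_apply_self b c y) (hybrid n a b c i)
  rw [← hybrid_succ, ← ht, anti_append, anti_append] at h2
  rw [← ht, ← h2]
  simp [anti, swap_apply_fixed hab hac]

theorem mem_of_mem_hybrid {n i : ℕ} {x : α} (h : x ∈ hybrid n a b c i) :
    x ∈ ({a, b, c} : Set α) := by
  induction i generalizing x with
  | zero =>
    have : x ∈ List.replicate n a ++ [b] := h
    rcases List.mem_append.1 this with h | h
    · exact Or.inl (List.eq_of_mem_replicate h)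
    · exact Or.inr (Or.inl (List.mem_singleton.1 h))
  | succ i ih =>
    rw [hybrid_succ_eq_doubling] at h
    obtain ⟨y, hy, hx⟩ := mem_doubling h
    have := ih (mem_Pal_one.1 hy)
    rcases hx with rfl | rfl
    · exact this
    · rw [Equiv.swap_apply_def]
      split_ifs <;> simp_all

omit [DecidableEq α] in
theorem le_of_replicate_prefix (hab : a ≠ b) (hn : 1 ≤ n) {r : ℕ} {x : α} {u : List α}
    (h : List.replicate r x <+: u) (hu : List.replicate n a ++ [b] <+: u) : r ≤ n := by
  by_contra! hr
  obtain ⟨d, rfl⟩ := Nat.exists_eq_add_of_le (show n + 1 ≤ r from hr)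
  have h1 : List.replicate (n + 1) x <+: u := by
    refine List.IsPrefix.trans ?_ h
    exact ⟨_, (List.replicate_add ..).symm⟩
  have h2 := (List.prefix_of_prefix_length_le hu h1 (by simp)).eq_of_length (by simp)
  have hb : b = x := List.eq_of_mem_replicate (n := n + 1) (by rw [← h2]; simp)
  have ha : a = x := List.eq_of_mem_replicate (n := n + 1) (by
    rw [← h2]; exact List.mem_append_left _ (List.mem_replicate.2 ⟨by omega, rfl⟩))
  exact hab (ha.trans hb.symm)

theorem runsLE_hybrid_succ (hab : a ≠ b) (hac : a ≠ c) (hbc : b ≠ c) (hn : 1 ≤ n) (i : ℕ) :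
    RunsLE (n + 1) (hybrid n a b c (i + 1)) := by
  intro x m h
  rw [hybrid_succ_eq_doubling] at h
  by_cases hx : Equiv.swap b c x = x
  · obtain ⟨r, h1, h2⟩ :=
      exists_replicate_prefix (replicate_infix_of_replicate_infix_doubling hx h)
    have h3 := hybrid_prefix_add hab hac hbc n 0 i
    rw [Nat.zero_add] at h3
    have := le_of_replicate_prefix hab hn h1 h3
    omega
  · have := le_two_of_replicate_infix_doubling hx h
    omega

theorem exists_hybrid_two_eq (hab : a ≠ b) (hac : a ≠ c) (hbc : b ≠ c) (hn : 1 ≤ n) :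
    ∃ p q, hybrid n a b c 2 = p ++ List.replicate (n + 1) a ++ q ∧ a ∈ p ∧ a ∈ q := by
  obtain ⟨r, hr⟩ := hybrid_one_prefix hab hac hbc n
  obtain ⟨s, hs⟩ := hybrid_suffix hab hac hbc n 0
  obtain ⟨k, rfl⟩ := Nat.exists_eq_add_of_le' hn
  have hlast : a ∈ c :: r := by
    have h1 : (hybrid (k + 1) a b c 1).getLast? = some a := by
      rw [← hs, List.replicate_succ', ← List.append_assoc, ← List.append_assoc,
        List.getLast?_concat]
    have h2 : hybrid (k + 1) a b c 1 = (List.replicate (k + 1) a ++ [b]) ++ (c :: r) := by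
      rw [← hr]; simp
    rw [h2, List.getLast?_append_of_ne_nil _ (by simp)] at h1
    exact List.mem_of_getLast? h1
  have h1 : hybrid (k + 1) a b c 1 = List.replicate (k + 1) a ++ (b :: c :: r) := by
    rw [← hr]; simp
  have ht : a ∈ Pal 1 (b :: c :: r) := mem_Pal_one.2 (List.mem_cons_of_mem _ hlast)
  obtain ⟨p₀, q₀, h0⟩ := List.append_of_mem ht
  have hl : (Pal 1 (b :: c :: r)).getLast? = some b := by
    rw [Pal_one_cons, List.getLast?_concat]
  have hh : (Pal 1 (b :: c :: r)).head? = some b := by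
    rw [← reverse_Pal_one, List.head?_reverse, hl]
  -- Pal(bcr) begins and ends with b, so its chosen a is interior; prefixing a^n then puts further
  -- a's on both sides of the run.
  have hp₀ : p₀ ≠ [] := by
    rintro rfl
    rw [h0] at hh
    exact hab (by simpa using hh)
  have hq₀ : ∃ y ∈ q₀, y ≠ a := by
    rw [h0, List.append_cons] at hl
    rcases eq_or_ne q₀ [] with rfl | hq
    · rw [List.append_nil, List.getLast?_concat] at hl
      exact absurd (by simpa using hl) hab
    · rw [List.getLast?_append_of_ne_nil _ hq] at hl
      exact ⟨b, List.mem_of_getLast? hl, hab.symm⟩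
  obtain ⟨p, q, h2, h3, h4⟩ := Pal_one_replicate_append h0 (k + 1)
  refine ⟨doubling (Equiv.swap b c) p, doubling (Equiv.swap b c) q, ?_,
    mem_doubling_of_mem ((h3 hp₀).2 (Nat.succ_pos k)),
    mem_doubling_of_mem ((h4 hq₀).2 (Nat.succ_pos k))⟩
  rw [hybrid_succ_eq_doubling, h1, h2, doubling_append, doubling_append,
    doubling_replicate (swap_apply_fixed hab hac)]

theorem frequently_eq_of_mem (hab : a ≠ b) (hac : a ≠ c) (hbc : b ≠ c) (hn : 1 ≤ n) {s : ℕ → α}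
    (hs : ∀ i, block s 0 (hybrid n a b c i).length = hybrid n a b c i) {x : α}
    (hx : x ∈ ({a, b, c} : Set α)) : ∃ᶠ i in atTop, s i = x := by
  rw [frequently_atTop]
  intro N
  -- The index makes this iterate at least N+n+2 long, so its suffix bca^n of length n+2 starts at
  -- position N or later.
  obtain ⟨p, hp⟩ := hybrid_suffix hab hac hbc n (N + n + 1)
  have hlen := le_length_hybrid hab hac hbc n (N + n + 1 + 1)
  have hpl : N ≤ p.length := by
    rw [← hp] at hlen
    simp at hlen
    omega
  have hmem : x ∈ [b, c] ++ List.replicate n a := by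
    rcases hx with rfl | rfl | rfl
    · exact List.mem_append_right _ (List.mem_replicate.2 ⟨by omega, rfl⟩)
    · simp
    · simp
  obtain ⟨p', q', hpq⟩ := List.append_of_mem hmem
  have h := congrArg (fun l : List α => l[(p ++ p').length]?) (hs (N + n + 1 + 1))
  rw [← hp, hpq, ← List.append_assoc, List.getElem?_append_right le_rfl, getElem?_block,
    if_pos (by simp)] at h
  exact ⟨(p ++ p').length, by simp; omega, by simpa using h⟩

end Hybrid

end EpiWords

/-! ### The main theorem -/

theorem corollaryh {α : Type*} [DecidableEq α] (a b c : α) (hab : a ≠ b) (hac : a ≠ c)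
    (hbc : b ≠ c) (n : ℕ) (hn : 1 ≤ n) :
    ∃ s w : ℕ → α,
      EpiWords.IsHybridFixedWord n a b c s ∧ EpiWords.IsIPal 1 s w ∧
      EpiWords.IsStrictStandardEpisturmian {a, b, c} w ∧
      EpiWords.IsPowerFree (n + 4) w ∧ EpiWords.ContainsPower (n + 3) w := by
  open EpiWords in
  have hlen := le_length_hybrid hab hac hbc n
  obtain ⟨s, hs, hslim⟩ := exists_limitWord
    (fun i => hybrid_prefix_add hab hac hbc n i 1) hlen
  have hlenf : ∀ m, m ≤ (Pal 1 (block s 0 m)).length := fun m => by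
    simpa [Pal] using (Pal_prefix_append 1 [] (block s 0 m)).2
  obtain ⟨w, hw, hwlim⟩ := exists_limitWord (f := fun m => Pal 1 (block s 0 m))
    (fun m => by rw [block_succ]; exact (Pal_prefix_append 1 _ _).1) hlenf
  have hfac := isFactor_iff hlenf hw
  refine ⟨s, w, hslim, hwlim, ⟨s, fun i => ?_, fun x hx => ?_, hwlim⟩, ?_, ?_⟩
  · apply mem_of_mem_hybrid (n := n) (i := i + 1)
    rw [← hs]
    exact List.mem_of_getElem? (i := i) (by
      rw [getElem?_block, if_pos (Nat.lt_of_succ_le (hlen (i + 1))), Nat.zero_add])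
  · exact frequently_eq_of_mem hab hac hbc hn hs hx
  · rintro ⟨u, hu, h⟩
    obtain ⟨m, hm⟩ := (hfac _).1 h
    refine power_not_infix (l := n + 1) ?_ hu hm
    refine (runsLE_hybrid_succ hab hac hbc hn m).infix ?_
    rw [← hs]
    exact (block_prefix_block s ((Nat.le_succ m).trans (hlen (m + 1)))).isInfix
  · obtain ⟨p, q, h, hp, hq⟩ := exists_hybrid_two_eq hab hac hbc hn
    -- The run a^(n+1) after p gives the exponent (n+1)+2.
    refine ⟨epiComp p [a], ?_, (hfac _).2 ⟨(hybrid n a b c 2).length, ?_⟩⟩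
    · exact List.length_pos_iff.1 (length_epiComp_singleton_pos p a)
    · rw [hs, h]
      exact power_infix hp hq
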